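/- Let $h\ge 1$ and let $T$ be the uniform binary AND-OR tree of height $h$: every internal node has exactly two children, all leaves are at distance $h$ from the root, the root is an AND-node, and AND layers and OR layers alternate. A truth assignment is a map from the set of leaves of $T$ to $\{0,1\}$ ($0$ = false, $1$ = true); it determines the value of every node, in particular of the root. A distribution is a probability distribution on the set of truth assignments. It is an independent distribution (ID) if the values of the leaves are mutually independent, and an independent identical distribution (IID) if it is an ID under which all the leaves have the same probability of having the value $0$. A deterministic alpha-beta pruning algorithm on $T$ finds the value of the root by probing leaves one at a time, depth-first and with cut-offs: to evaluate a leaf it probes it; to evaluate an internal node it chooses one of the two children, evaluates this child first, stops if the value of this child settles the value of the node (the value $0$ at an AND-node, the value $1$ at an OR-node), and otherwise evaluates the other child. All choices may depend on the answers obtained so far. For such an algorithm $A$ and a distribution $\delta$, let $C(A,\delta)$ be the expected number of leaves probed by $A$ under $\delta$. Let $r$ be a real number with $0<r<1$, and let $\mathcal D_r$ be the set of all IDs $\delta$ on $T$ under which the root has the value $0$ with probability $r$. Suppose that $d\in\mathcal D_r$ satisfies $$\min_A C(A,d)=\max_{\delta\in\mathcal D_r}\ \min_A C(A,\delta),$$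 where $A$ runs over all deterministic alpha-beta pruning algorithms on $T$. Then $d$ is an IID. -/

import Mathlib

open MeasureTheory ProbabilityTheory

namespace AndOr

/-- The two kinds of internal nodes. -/
inductive Gate where
  | and
  | or

/-- The kind of node found on the next layer: AND layers and OR layers alternate. -/
def Gate.dual : Gate → Gate
  | .and => .or
  | .or => .and

/-- The value of a child that settles the value of a node of this kind
(0 = `false` at an AND-node, 1 = `true` at an OR-node). -/
def Gate.absorbing : Gate → Bool
  | .and => false
  | .or => true

/-- The Boolean function computed at a node. -/
def Gate.op : Gate → Bool → Bool → Bool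
  | .and => Bool.and
  | .or => Bool.or

/-- The leaves of the uniform binary tree of height `h`, named by their path from the root
(`false` = left, `true` = right). -/
abbrev Leaf (h : ℕ) : Type := Fin h → Bool

/-- Truth assignments: mappings of the leaves to `{0, 1}`, with 0 = `false` and 1 = `true`. -/
abbrev Assignment (h : ℕ) : Type := Leaf h → Bool

/-- Restriction of a truth assignment to the left (`b = false`) or right (`b = true`)
sub-tree under the root. -/
def Assignment.restrict {h : ℕ} (b : Bool) (f : Assignment (h + 1)) : Assignment h :=
  fun l => f (Fin.cons b l)

/-- The value of the root of the uniform binary tree of height `h` whose root is of kind `g`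
(with alternating layers), under a truth assignment. -/
def rootValue : {h : ℕ} → Gate → Assignment h → Bool
  | 0, _, f => f Fin.elim0
  | _ + 1, g, f =>
      g.op (rootValue g.dual (Assignment.restrict false f))
        (rootValue g.dual (Assignment.restrict true f))

/-- Deterministic alpha-beta pruning algorithms on the uniform binary tree of height `h`.
At a leaf, the leaf is probed. At an internal node, the algorithm chooses the child `b` to be
evaluated first and evaluates it by an algorithm `first`; if this does not settle the value of
the node, it evaluates the other child. How the other child is evaluated may depend on the
answers obtained so far: `second t` is the algorithm used there when `t` is the list of the
answers that `first` got, in the order of the queries. In particular, the algorithm need not be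
directional. -/
inductive AlphaBeta : ℕ → Type where
  | leaf : AlphaBeta 0
  | node {h : ℕ} (b : Bool) (first : AlphaBeta h) (second : List Bool → AlphaBeta h) :
      AlphaBeta (h + 1)

/-- Execution of an algorithm on a truth assignment, for the tree with root of kind `g`. The
result is the value found for the root together with the list of the values of all probed leaves,
in the order in which they are probed. -/
def AlphaBeta.run : {h : ℕ} → Gate → AlphaBeta h → Assignment h → Bool × List Bool
  | _, _, .leaf, f => (f Fin.elim0, [f Fin.elim0])
  | _, g, .node b first second, f =>
      let s := first.run g.dual (Assignment.restrict b f)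
      if s.1 = g.absorbing then s
      else
        let s' := (second s.2).run g.dual (Assignment.restrict (!b) f)
        (s'.1, s.2 ++ s'.2)

/-- Every algorithm finds the correct value of the root. -/
theorem AlphaBeta.run_fst {h : ℕ} (g : Gate) (A : AlphaBeta h) (f : Assignment h) :
    (A.run g f).1 = rootValue g f := by
  induction A generalizing g with
  | leaf => rfl
  | node b first second ih1 ih2 =>
    have e1 := ih1 g.dual (Assignment.restrict b f)
    have e2 := ih2 (first.run g.dual (Assignment.restrict b f)).2 g.dual
      (Assignment.restrict (!b) f)
    simp only [AlphaBeta.run, rootValue]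
    split_ifs with hc
    · rw [e1] at hc ⊢
      rw [hc]
      cases g <;> cases b <;> simp_all [Gate.op, Gate.absorbing]
    · rw [e1] at hc
      simp only [e2]
      cases g <;> cases b <;> simp_all [Gate.op, Gate.absorbing]

/-- The cost of an algorithm on a truth assignment: the number of probed leaves. -/
def AlphaBeta.probes {h : ℕ} (g : Gate) (A : AlphaBeta h) (f : Assignment h) : ℕ :=
  (A.run g f).2.length

/-- `C(A, d)`: the expected number of probed leaves under a distribution `d` on the truth
assignments. -/
noncomputable def cost {h : ℕ} (g : Gate) (A : AlphaBeta h)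
    (d : ProbabilityMeasure (Assignment h)) : ℝ :=
  ∫ f, (A.probes g f : ℝ) ∂(d : Measure (Assignment h))

/-- The minimum of `C(A, d)` over all deterministic alpha-beta pruning algorithms `A`. -/
noncomputable def minCost {h : ℕ} (g : Gate) (d : ProbabilityMeasure (Assignment h)) : ℝ :=
  ⨅ A : AlphaBeta h, cost g A d

instance instNonemptyAlphaBeta (h : ℕ) : Nonempty (AlphaBeta h) := by
  induction h with
  | zero => exact ⟨.leaf⟩
  | succ n ih => exact ih.elim fun A => ⟨.node false A fun _ => A⟩

theorem AlphaBeta.probes_le {h : ℕ} (g : Gate) (A : AlphaBeta h) (f : Assignment h) :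
    A.probes g f ≤ 2 ^ h := by
  induction A generalizing g with
  | leaf => simp [AlphaBeta.probes, AlphaBeta.run]
  | node b first second ih1 ih2 =>
    have e1 := ih1 g.dual (Assignment.restrict b f)
    have e2 := ih2 (first.run g.dual (Assignment.restrict b f)).2 g.dual
      (Assignment.restrict (!b) f)
    simp only [AlphaBeta.probes, AlphaBeta.run] at *
    split_ifs <;> simp only [List.length_append, pow_succ] <;> omega

/-- The infimum in `minCost` is a minimum. -/
theorem minCost_isLeast {h : ℕ} (g : Gate) (d : ProbabilityMeasure (Assignment h)) :
    IsLeast (Set.range fun A : AlphaBeta h => cost g A d) (minCost g d) := by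
  have hfin : (Set.range fun A : AlphaBeta h => cost g A d).Finite := by
    refine (Set.finite_range fun c : Assignment h → Fin (2 ^ h + 1) =>
      ∫ f, ((c f : ℕ) : ℝ) ∂(d : Measure (Assignment h))).subset ?_
    rintro _ ⟨A, rfl⟩
    exact ⟨fun f => ⟨A.probes g f, Nat.lt_succ_of_le (A.probes_le g f)⟩, rfl⟩
  have hne : (Set.range fun A : AlphaBeta h => cost g A d).Nonempty := Set.range_nonempty _
  exact ⟨hne.csInf_mem hfin, fun _ hx => csInf_le hfin.bddBelow hx⟩

/-- The probability (of having the value 0) of the leaf `l`. -/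
noncomputable def leafProb {h : ℕ} (d : ProbabilityMeasure (Assignment h)) (l : Leaf h) : ℝ :=
  (d : Measure (Assignment h)).real {f | f l = false}

/-- The probability (of having the value 0) of the root. -/
noncomputable def rootProb {h : ℕ} (g : Gate) (d : ProbabilityMeasure (Assignment h)) : ℝ :=
  (d : Measure (Assignment h)).real {f | rootValue g f = false}

/-- Independent distributions (ID): the values of the leaves are mutually independent. -/
def IsID {h : ℕ} (d : ProbabilityMeasure (Assignment h)) : Prop :=
  iIndepFun (fun (l : Leaf h) (f : Assignment h) => f l) (d : Measure (Assignment h))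

/-- Independent identical distributions (IID): IDs all of whose leaves have the same probability. -/
def IsIID {h : ℕ} (d : ProbabilityMeasure (Assignment h)) : Prop :=
  IsID d ∧ ∀ l l' : Leaf h, leafProb d l = leafProb d l'

/-- Eigen-distributions with respect to a class `B` of distributions: the elements of `B` whose
minimum cost is the maximum of the minimum costs over `B`. -/
def IsEigenDistribution {h : ℕ} (g : Gate) (B : Set (ProbabilityMeasure (Assignment h)))
    (d : ProbabilityMeasure (Assignment h)) : Prop :=
  d ∈ B ∧ IsGreatest (minCost g '' B) (minCost g d)

end AndOr

/-! Describe each node by the probability that it takes the absorbing value of its own kind. If the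
children have probabilities `p` and `q`, the node has `1 - p * q`, and starting with the `p`-child
costs the cost of that child plus `p` times the cost of the other, whatever the gate. By
independence, answers in one subtree carry no information about the other, so the minimum cost obeys
the recursion `optCost`; at identical leaves it becomes a function F = `iidCost h` of the root
probability alone.

The crux is `iidCost_unbalanced_lt`. F is concave, and a line `a + b * x` supporting it at `s = √(p
* q)` has `a + b > 0` because F is positive at 1. Replacing F by this line reduces `F p + p * F q <
F s + s * F s` to `(a + b) * p < (a + b) * s`, which holds for `0 < p < q`. Evaluating the child of
smaller probability first then gives `optCost ≤ iidCost` by induction. When the root probability is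
strictly between 0 and 1, equality forces balanced children that are themselves extremal, hence
constant leaves. Some IID has root probability `r` and attains the bound, so every maximiser attains
it. -/

namespace AndOr

/-! ### Product weights on truth assignments -/

/-- The probability of a Boolean value when `false` has probability `p`. -/
def bitWeight (p : ℝ) (b : Bool) : ℝ := if b then 1 - p else p

theorem bitWeight_nonneg {p : ℝ} (hp : p ∈ Set.Icc (0 : ℝ) 1) (b : Bool) :
    0 ≤ bitWeight p b := by
  cases b
  · simpa [bitWeight] using hp.1
  · simpa [bitWeight] using hp.2

/-- The probability of a truth assignment under independent leaves with probabilities `x`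
of having the value 0. -/
def weight {h : ℕ} (x : Leaf h → ℝ) (f : Assignment h) : ℝ := ∏ l, bitWeight (x l) (f l)

/-- The restriction of leaf probabilities to a sub-tree under the root. -/
def subProb {h : ℕ} (b : Bool) (x : Leaf (h + 1) → ℝ) : Leaf h → ℝ := fun l => x (Fin.cons b l)

/-- The expectation under independent leaves. -/
def expect {h : ℕ} (x : Leaf h → ℝ) (φ : Assignment h → ℝ) : ℝ := ∑ f, weight x f * φ f

/-- Leaf probabilities lie in the unit interval. -/
def IsProb {h : ℕ} (x : Leaf h → ℝ) : Prop := ∀ l, x l ∈ Set.Icc (0 : ℝ) 1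

theorem IsProb.sub {h : ℕ} {x : Leaf (h + 1) → ℝ} (hx : IsProb x) (b : Bool) :
    IsProb (subProb b x) := fun _ => hx _

theorem prod_leaf_succ {h : ℕ} (b : Bool) (F : Leaf (h + 1) → ℝ) :
    ∏ l, F l = (∏ l : Leaf h, F (Fin.cons b l)) * ∏ l : Leaf h, F (Fin.cons (!b) l) := by
  rw [← (Fin.consEquiv (fun _ : Fin (h + 1) => Bool)).prod_comp, Fintype.prod_prod_type,
    Fintype.prod_bool]
  cases b
  · exact mul_comm _ _
  · rfl

theorem weight_succ {h : ℕ} (b : Bool) (x : Leaf (h + 1) → ℝ) (f : Assignment (h + 1)) :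
    weight x f = weight (subProb b x) (f.restrict b) * weight (subProb (!b) x) (f.restrict !b) :=
  prod_leaf_succ b _

theorem weight_nonneg {h : ℕ} {x : Leaf h → ℝ} (hx : IsProb x) (f : Assignment h) :
    0 ≤ weight x f :=
  Finset.prod_nonneg fun l _ => bitWeight_nonneg (hx l) _

/-- A truth assignment amounts to truth assignments of the two sub-trees under the root. -/
def assignmentEquiv {h : ℕ} (b : Bool) : Assignment (h + 1) ≃ Assignment h × Assignment h where
  toFun f := (f.restrict b, f.restrict !b)
  invFun p := fun l => if l 0 = b then p.1 (Fin.tail l) else p.2 (Fin.tail l)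
  left_inv f := by
    funext l
    by_cases hl : l 0 = b
    · simp only [hl, if_true, Assignment.restrict]
      rw [← hl, Fin.cons_self_tail]
    · have hb : (!b) = l 0 := by cases b <;> simpa using hl
      simp only [hl, if_false, Assignment.restrict]
      rw [hb, Fin.cons_self_tail]
  right_inv p := by
    ext l <;> simp [Assignment.restrict]

theorem expect_succ {h : ℕ} (b : Bool) (x : Leaf (h + 1) → ℝ)
    (φ : Assignment h → Assignment h → ℝ) :
    expect x (fun f => φ (f.restrict b) (f.restrict !b)) =
      expect (subProb b x) fun f₁ => expect (subProb (!b) x) fun f₂ => φ f₁ f₂ := by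
  simp only [expect, weight_succ b x]
  refine ((assignmentEquiv b).sum_comp fun p : Assignment h × Assignment h =>
    weight (subProb b x) p.1 * weight (subProb (!b) x) p.2 * φ p.1 p.2).trans ?_
  rw [Fintype.sum_prod_type]
  simp only [Finset.mul_sum, mul_assoc]

theorem expect_mul_left {h : ℕ} (x : Leaf h → ℝ) (c : ℝ) (φ : Assignment h → ℝ) :
    expect x (fun f => c * φ f) = c * expect x φ := by
  simp only [expect, Finset.mul_sum]
  exact Finset.sum_congr rfl fun _ _ => by ring

theorem expect_mul_right {h : ℕ} (x : Leaf h → ℝ) (c : ℝ) (φ : Assignment h → ℝ) :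
    expect x (fun f => φ f * c) = expect x φ * c := by
  simp only [mul_comm _ c, expect_mul_left]

theorem expect_add {h : ℕ} (x : Leaf h → ℝ) (φ ψ : Assignment h → ℝ) :
    expect x (fun f => φ f + ψ f) = expect x φ + expect x ψ := by
  simp only [expect, mul_add, Finset.sum_add_distrib]

theorem expect_sub {h : ℕ} (x : Leaf h → ℝ) (φ ψ : Assignment h → ℝ) :
    expect x (fun f => φ f - ψ f) = expect x φ - expect x ψ := by
  simp only [expect, mul_sub, Finset.sum_sub_distrib]

theorem expect_const {h : ℕ} (x : Leaf h → ℝ) (c : ℝ) : expect x (fun _ => c) = c := by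
  have h1 : ∑ f, weight x f = 1 := by
    have e := Finset.prod_univ_sum (fun _ : Leaf h => (Finset.univ : Finset Bool))
      fun l b => bitWeight (x l) b
    rw [Fintype.piFinset_univ] at e
    refine e.symm.trans ?_
    simp [bitWeight]
  rw [expect, ← Finset.sum_mul, h1, one_mul]

theorem expect_mono {h : ℕ} {x : Leaf h → ℝ} (hx : IsProb x) {φ ψ : Assignment h → ℝ}
    (hφ : ∀ f, φ f ≤ ψ f) : expect x φ ≤ expect x ψ :=
  Finset.sum_le_sum fun f _ => mul_le_mul_of_nonneg_left (hφ f) (weight_nonneg hx f)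

/-! ### Probability of the absorbing value and optimal cost -/

/-- The probability that the root, of kind `g`, has the absorbing value of `g`. -/
def absProb : {h : ℕ} → Gate → (Leaf h → ℝ) → ℝ
  | 0, .and, x => x Fin.elim0
  | 0, .or, x => 1 - x Fin.elim0
  | _ + 1, g, x => 1 - absProb g.dual (subProb false x) * absProb g.dual (subProb true x)

/-- The minimum cost under independent leaves, computed recursively. -/
noncomputable def optCost : {h : ℕ} → Gate → (Leaf h → ℝ) → ℝ
  | 0, _, _ => 1
  | _ + 1, g, x =>
      min (optCost g.dual (subProb false x) +
          absProb g.dual (subProb false x) * optCost g.dual (subProb true x))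
        (optCost g.dual (subProb true x) +
          absProb g.dual (subProb true x) * optCost g.dual (subProb false x))

/-- The indicator of the event that the root has the absorbing value of its kind. -/
def absInd {h : ℕ} (g : Gate) (f : Assignment h) : ℝ :=
  if rootValue g f = g.absorbing then 1 else 0

theorem absInd_nonneg {h : ℕ} (g : Gate) (f : Assignment h) : 0 ≤ absInd g f := by
  unfold absInd; split_ifs <;> norm_num

/-- A node escapes its absorbing value exactly when both children take the absorbing value of the
dual gate. This makes the recursion the same for both gates. -/
theorem absInd_succ {h : ℕ} (g : Gate) (f : Assignment (h + 1)) :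
    absInd g f = 1 - absInd g.dual (f.restrict false) * absInd g.dual (f.restrict true) := by
  have key : ∀ a b : Bool, (if g.op a b = g.absorbing then (1 : ℝ) else 0) =
      1 - (if a = g.dual.absorbing then 1 else 0) * if b = g.dual.absorbing then 1 else 0 := by
    cases g <;> rintro (_ | _) (_ | _) <;> simp [Gate.dual, Gate.op, Gate.absorbing]
  exact key _ _

theorem weight_zero (x : Leaf 0 → ℝ) (f : Assignment 0) :
    weight x f = bitWeight (x Fin.elim0) (f Fin.elim0) := by
  have : (Finset.univ : Finset (Leaf 0)) = {Fin.elim0} :=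
    Finset.eq_singleton_iff_unique_mem.2 ⟨Finset.mem_univ _, fun _ _ => Subsingleton.elim _ _⟩
  rw [weight, this, Finset.prod_singleton]

theorem expect_zero (x : Leaf 0 → ℝ) (φ : Bool → ℝ) :
    expect x (fun f => φ (f Fin.elim0)) =
      x Fin.elim0 * φ false + (1 - x Fin.elim0) * φ true := by
  simp only [expect, weight_zero]
  rw [(Equiv.funUnique (Leaf 0) Bool).symm.sum_comp (fun f : Assignment 0 =>
    bitWeight (x Fin.elim0) (f Fin.elim0) * φ (f Fin.elim0)) |>.symm, Fintype.sum_bool]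
  simp [bitWeight, add_comm]

theorem expect_absInd {h : ℕ} (g : Gate) (x : Leaf h → ℝ) :
    expect x (absInd g) = absProb g x := by
  induction h generalizing g with
  | zero =>
    have := expect_zero x fun b => if b = g.absorbing then (1 : ℝ) else 0
    refine Eq.trans this ?_
    cases g <;> simp [absProb, Gate.absorbing]
  | succ h ih =>
    rw [absProb, ← ih, ← ih]
    have e := expect_succ false x fun f₁ f₂ => 1 - absInd g.dual f₁ * absInd g.dual f₂
    simp only [expect_sub, expect_mul_left, expect_mul_right, expect_const, Bool.not_false] at e
    rw [← e, funext (absInd_succ g), expect_sub, expect_const]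

theorem absProb_mem {h : ℕ} (g : Gate) {x : Leaf h → ℝ} (hx : IsProb x) :
    absProb g x ∈ Set.Icc (0 : ℝ) 1 := by
  induction h generalizing g with
  | zero =>
    have := hx Fin.elim0
    cases g
    · exact this
    · exact ⟨sub_nonneg.2 this.2, sub_le_self _ this.1⟩
  | succ h ih =>
    have h0 := ih g.dual (hx.sub false)
    have h1 := ih g.dual (hx.sub true)
    exact ⟨sub_nonneg.2 (mul_le_one₀ h0.2 h1.1 h1.2), sub_le_self _ (mul_nonneg h0.1 h1.1)⟩

theorem probes_node {h : ℕ} (g : Gate) (b : Bool) (A : AlphaBeta h)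
    (B : List Bool → AlphaBeta h) (f : Assignment (h + 1)) :
    ((AlphaBeta.node b A B).probes g f : ℝ) = A.probes g.dual (f.restrict b) +
      absInd g.dual (f.restrict b) *
        (B (A.run g.dual (f.restrict b)).2).probes g.dual (f.restrict !b) := by
  have e := A.run_fst g.dual (f.restrict b)
  have hd : (rootValue g.dual (f.restrict b) = g.absorbing) ↔
      ¬ rootValue g.dual (f.restrict b) = g.dual.absorbing := by
    cases g <;> simp [Gate.absorbing, Gate.dual]
  have hne : ¬ g.absorbing = g.dual.absorbing := by cases g <;> simp [Gate.absorbing, Gate.dual]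
  simp only [AlphaBeta.probes, AlphaBeta.run, absInd, e]
  by_cases hc : rootValue g.dual (f.restrict b) = g.absorbing
  · simp [hc, hne]
  · rw [if_neg hc, if_pos (not_not.1 fun hh => hc (hd.2 hh))]
    simp

theorem expect_probes_node {h : ℕ} (g : Gate) (b : Bool) (A : AlphaBeta h)
    (B : List Bool → AlphaBeta h) (x : Leaf (h + 1) → ℝ) :
    expect x (fun f => ((AlphaBeta.node b A B).probes g f : ℝ)) =
      expect (subProb b x) (fun f => (A.probes g.dual f : ℝ)) +
        expect (subProb b x) (fun f => absInd g.dual f *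
          expect (subProb (!b) x) fun f₂ => ((B (A.run g.dual f).2).probes g.dual f₂ : ℝ)) := by
  simp only [probes_node]
  rw [expect_succ b x (fun f₁ f₂ => (A.probes g.dual f₁ : ℝ) + absInd g.dual f₁ *
    (B (A.run g.dual f₁).2).probes g.dual f₂)]
  simp only [expect_add, expect_const, expect_mul_left]

theorem optCost_succ_le {h : ℕ} (g : Gate) (x : Leaf (h + 1) → ℝ) (b : Bool) :
    optCost g x ≤ optCost g.dual (subProb b x) +
      absProb g.dual (subProb b x) * optCost g.dual (subProb (!b) x) := by
  cases b
  · exact min_le_left _ _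
  · exact min_le_right _ _

/-- Adapting to earlier answers does not help: each possible continuation on the second subtree
faces the same product distribution, so it costs at least the optimum there. -/
theorem optCost_le_expect {h : ℕ} (g : Gate) (A : AlphaBeta h) {x : Leaf h → ℝ}
    (hx : IsProb x) : optCost g x ≤ expect x fun f => (A.probes g f : ℝ) := by
  induction A generalizing g with
  | leaf => simp [optCost, AlphaBeta.probes, AlphaBeta.run, expect_const]
  | node b A B ihA ihB =>
    rw [expect_probes_node]
    refine (optCost_succ_le g x b).trans (add_le_add (ihA g.dual (hx.sub b)) ?_)
    rw [← expect_absInd, ← expect_mul_right]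
    exact expect_mono (hx.sub b) fun f =>
      mul_le_mul_of_nonneg_left (ihB _ g.dual (hx.sub _)) (absInd_nonneg _ _)

/-- The optimum is reached by an algorithm whose second phase ignores the answers of the first. -/
theorem exists_expect_eq_optCost {h : ℕ} (g : Gate) (x : Leaf h → ℝ) :
    ∃ A : AlphaBeta h, (expect x fun f => (A.probes g f : ℝ)) = optCost g x := by
  induction h generalizing g with
  | zero => exact ⟨.leaf, by simp [optCost, AlphaBeta.probes, AlphaBeta.run, expect_const]⟩
  | succ h ih =>
    have key : ∀ b, ∃ A : AlphaBeta (h + 1), (expect x fun f => (A.probes g f : ℝ)) =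
        optCost g.dual (subProb b x) +
          absProb g.dual (subProb b x) * optCost g.dual (subProb (!b) x) := by
      intro b
      obtain ⟨A, hA⟩ := ih g.dual (subProb b x)
      obtain ⟨B, hB⟩ := ih g.dual (subProb (!b) x)
      refine ⟨.node b A fun _ => B, ?_⟩
      rw [expect_probes_node, hA, hB, expect_mul_right, expect_absInd]
    rw [optCost]
    rcases min_choice (optCost g.dual (subProb false x) +
          absProb g.dual (subProb false x) * optCost g.dual (subProb true x))
        (optCost g.dual (subProb true x) +
          absProb g.dual (subProb true x) * optCost g.dual (subProb false x)) with e | e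
    · rw [e]; exact key false
    · rw [e]; exact key true

/-! ### The extremal cost as a function of the probability -/

/-- The cost under identical leaves, as a function of the probability of the absorbing value
of the root. -/
noncomputable def iidCost : ℕ → ℝ → ℝ
  | 0, _ => 1
  | h + 1, p => iidCost h (√(1 - p)) * (1 + √(1 - p))

theorem iidCost_pos (h : ℕ) (p : ℝ) : 0 < iidCost h p := by
  induction h generalizing p with
  | zero => exact one_pos
  | succ h ih => exact mul_pos (ih _) (by positivity)

/-- `iidCost h` is concave on the unit interval: it has a supporting line at each interior
point. -/
theorem exists_supporting_line (h : ℕ) {s : ℝ} (hs0 : 0 < s) (hs1 : s < 1) :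
    ∃ a b : ℝ, iidCost h s = a + b * s ∧ ∀ p ∈ Set.Icc (0 : ℝ) 1, iidCost h p ≤ a + b * p := by
  induction h generalizing s with
  | zero => exact ⟨1, 0, by simp [iidCost], by simp [iidCost]⟩
  | succ h ih =>
    obtain ⟨t, ht⟩ : ∃ t, t = √(1 - s) := ⟨_, rfl⟩
    have ht0 : 0 < t := ht ▸ Real.sqrt_pos.2 (by linarith)
    have hsq : t ^ 2 = 1 - s := by rw [ht]; exact Real.sq_sqrt (by linarith)
    have ht1 : t < 1 := by nlinarith
    obtain ⟨a, b, he, hle⟩ := ih ht0 ht1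
    -- The line lies above `iidCost h` at 1, where the latter is positive.
    have hab : 0 < a + b := by
      have := hle 1 (by simp)
      have := iidCost_pos h 1
      linarith
    -- `√v ≤ (v + t²) / (2t)`
    refine ⟨a + b + (a + b) * ((1 + t ^ 2) / (2 * t)), -b - (a + b) / (2 * t), ?_, ?_⟩
    · rw [iidCost, ← ht, he]
      have : s = 1 - t ^ 2 := by linarith
      rw [this]
      field_simp
      ring
    · rintro p ⟨hp0, hp1⟩
      rw [iidCost]
      obtain ⟨v, hv⟩ : ∃ v, v = √(1 - p) := ⟨_, rfl⟩
      rw [← hv]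
      have hv0 : 0 ≤ v := hv ▸ Real.sqrt_nonneg _
      have hvsq : v ^ 2 = 1 - p := by rw [hv]; exact Real.sq_sqrt (by linarith)
      have hv1 : v ≤ 1 := by nlinarith
      have hp : p = 1 - v ^ 2 := by linarith
      have h1 : v ≤ (v ^ 2 + t ^ 2) / (2 * t) := by
        rw [le_div_iff₀ (by positivity)]
        nlinarith [sq_nonneg (v - t)]
      -- In the product with `1 + v`, the square `v ^ 2 = 1 - p` is already affine in `p`; the term
      -- `(a + b) * v` is bounded by the tangent of the square root, since `a + b > 0`.
      calc iidCost h v * (1 + v) ≤ (a + b * v) * (1 + v) :=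
            mul_le_mul_of_nonneg_right (hle v ⟨hv0, hv1⟩) (by linarith)
        _ = a + b * v ^ 2 + (a + b) * v := by ring
        _ ≤ a + b * v ^ 2 + (a + b) * ((v ^ 2 + t ^ 2) / (2 * t)) :=
            add_le_add_right (mul_le_mul_of_nonneg_left h1 hab.le) _
        _ = _ := by rw [hp]; field_simp; ring

/-- Unequal children of a node cost strictly less than equal ones. -/
theorem iidCost_unbalanced_lt (h : ℕ) {p q : ℝ} (hp : 0 < p) (hpq : p < q) (hq : q ≤ 1) :
    iidCost h p + p * iidCost h q < iidCost (h + 1) (1 - p * q) := by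
  rw [iidCost, sub_sub_cancel]
  obtain ⟨s, hs⟩ : ∃ s, s = √(p * q) := ⟨_, rfl⟩
  rw [← hs]
  have hq0 : 0 < q := hp.trans hpq
  have hs0 : 0 < s := hs ▸ Real.sqrt_pos.2 (by positivity)
  have hsq : s ^ 2 = p * q := by rw [hs]; exact Real.sq_sqrt (by positivity)
  have hs1 : s < 1 := by nlinarith
  have hps : p < s := by nlinarith
  obtain ⟨a, b, he, hle⟩ := exists_supporting_line h hs0 hs1
  have hab : 0 < a + b := by
    have := hle 1 (by simp)
    have := iidCost_pos h 1
    linarith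
  have h1 := hle p ⟨hp.le, by linarith⟩
  have h2 := mul_le_mul_of_nonneg_left (hle q ⟨hq0.le, hq⟩) hp.le
  have h3 : b * (p * q) = b * s ^ 2 := by rw [hsq]
  rw [he]
  -- The terms in `b * s ^ 2` cancel, leaving `(a + b) * p < (a + b) * s`.
  nlinarith [mul_pos hab (sub_pos.2 hps)]

theorem iidCost_balanced (h : ℕ) {p : ℝ} (hp : 0 ≤ p) :
    iidCost (h + 1) (1 - p * p) = iidCost h p + p * iidCost h p := by
  rw [iidCost, sub_sub_cancel, Real.sqrt_mul_self hp]
  ring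

theorem iidCost_unbalanced_le (h : ℕ) {p q : ℝ} (hp : 0 ≤ p) (hpq : p ≤ q) (hq : q ≤ 1) :
    iidCost h p + p * iidCost h q ≤ iidCost (h + 1) (1 - p * q) := by
  -- At `p = 0` both sides equal `iidCost h 0` for every `q`, so strictness fails there.
  rcases hp.eq_or_lt with rfl | hp'
  · simp [iidCost]
  rcases hpq.eq_or_lt with rfl | hpq'
  · exact (iidCost_balanced h hp).ge
  · exact (iidCost_unbalanced_lt h hp' hpq' hq).le

/-- One of the children has the smaller probability of an absorbing value. -/
theorem exists_first_child {h : ℕ} (g : Gate) (x : Leaf (h + 1) → ℝ) :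
    ∃ b : Bool, absProb g.dual (subProb b x) ≤ absProb g.dual (subProb (!b) x) ∧
      absProb g x = 1 - absProb g.dual (subProb b x) * absProb g.dual (subProb (!b) x) := by
  rcases le_total (absProb g.dual (subProb false x)) (absProb g.dual (subProb true x)) with hl | hl
  · exact ⟨false, hl, rfl⟩
  · exact ⟨true, hl, by rw [absProb, mul_comm]; rfl⟩

theorem optCost_le_iidCost {h : ℕ} (g : Gate) {x : Leaf h → ℝ} (hx : IsProb x) :
    optCost g x ≤ iidCost h (absProb g x) := by
  induction h generalizing g with
  | zero => exact le_rfl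
  | succ h ih =>
    obtain ⟨b, hb, he⟩ := exists_first_child g x
    have hp := absProb_mem g.dual (hx.sub b)
    have hq := absProb_mem g.dual (hx.sub !b)
    rw [he]
    refine (optCost_succ_le g x b).trans (le_trans ?_ (iidCost_unbalanced_le h hp.1 hb hq.2))
    exact add_le_add (ih _ (hx.sub b)) (mul_le_mul_of_nonneg_left (ih _ (hx.sub _)) hp.1)

/-- On nonnegative `p`, the map `p ↦ 1 - p * p` is injective at each layer. This later identifies
the constants found in the two subtrees. -/
theorem absProb_const_injective {h : ℕ} (g : Gate) {c c' : ℝ} (hc : c ∈ Set.Icc (0 : ℝ) 1)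
    (hc' : c' ∈ Set.Icc (0 : ℝ) 1)
    (he : absProb g (fun _ : Leaf h => c) = absProb g (fun _ : Leaf h => c')) : c = c' := by
  induction h generalizing g with
  | zero => cases g <;> simpa [absProb] using he
  | succ h ih =>
    refine ih g.dual ?_
    have h1 := (absProb_mem (h := h) g.dual (x := fun _ => c) fun _ => hc).1
    have h2 := (absProb_mem (h := h) g.dual (x := fun _ => c') fun _ => hc').1
    exact (mul_self_inj_of_nonneg h1 h2).1 (sub_right_injective he)

theorem optCost_const {h : ℕ} (g : Gate) {c : ℝ} (hc : c ∈ Set.Icc (0 : ℝ) 1) :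
    optCost g (fun _ : Leaf h => c) = iidCost h (absProb g fun _ : Leaf h => c) := by
  induction h generalizing g with
  | zero => rfl
  | succ h ih =>
    have h1 := (absProb_mem (h := h) g.dual (x := fun _ => c) fun _ => hc).1
    refine (min_self _).trans ?_
    change optCost g.dual (fun _ : Leaf h => c) +
      absProb g.dual (fun _ : Leaf h => c) * optCost g.dual (fun _ : Leaf h => c) = _
    rw [ih]
    exact (iidCost_balanced h h1).symm

theorem exists_absProb_const (h : ℕ) (g : Gate) {r : ℝ} (hr : r ∈ Set.Icc (0 : ℝ) 1) :
    ∃ c ∈ Set.Icc (0 : ℝ) 1, absProb g (fun _ : Leaf h => c) = r := by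
  induction h generalizing g r with
  | zero =>
    cases g
    · exact ⟨r, hr, rfl⟩
    · exact ⟨1 - r, ⟨sub_nonneg.2 hr.2, sub_le_self _ hr.1⟩, sub_sub_cancel _ _⟩
  | succ h ih =>
    obtain ⟨c, hc, he⟩ := ih g.dual (r := √(1 - r))
      ⟨Real.sqrt_nonneg _, Real.sqrt_le_one.2 (by linarith [hr.1])⟩
    refine ⟨c, hc, ?_⟩
    change 1 - absProb g.dual (fun _ : Leaf h => c) * absProb g.dual (fun _ : Leaf h => c) = r
    rw [he, Real.mul_self_sqrt (by linarith [hr.2]), sub_sub_cancel]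

/-- The maximum cost is attained at identical leaves only. -/
theorem exists_const_of_optCost_eq {h : ℕ} (g : Gate) {x : Leaf h → ℝ} (hx : IsProb x)
    (h0 : 0 < absProb g x) (h1 : absProb g x < 1)
    (he : optCost g x = iidCost h (absProb g x)) : ∃ c, ∀ l, x l = c := by
  induction h generalizing g with
  | zero => exact ⟨x Fin.elim0, fun l => by rw [Subsingleton.elim l Fin.elim0]⟩
  | succ h ih =>
    obtain ⟨b, hb, hu⟩ := exists_first_child g x
    have hp := absProb_mem g.dual (hx.sub b)
    have hq := absProb_mem g.dual (hx.sub !b)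
    have hA := optCost_le_iidCost g.dual (hx.sub b)
    have hB := optCost_le_iidCost g.dual (hx.sub !b)
    have hle := optCost_succ_le g x b
    -- The reverse order of evaluation: once the probabilities agree, it yields extremality of the
    -- second subtree without division by `p`.
    have hle' := optCost_succ_le g x !b
    rw [Bool.not_not] at hle'
    have ihA := ih g.dual (hx.sub b)
    have ihB := ih g.dual (hx.sub !b)
    have hbx : ∀ l : Leaf (h + 1), (∃ l', x l = subProb b x l') ∨ ∃ l', x l = subProb (!b) x l' := by
      intro l
      have hl : ∀ c, l 0 = c → x l = subProb c x (Fin.tail l) := by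
        rintro _ rfl
        rw [subProb, Fin.cons_self_tail]
      by_cases hlb : l 0 = b
      · exact .inl ⟨_, hl _ hlb⟩
      · exact .inr ⟨_, hl (!b) (by cases b <;> simpa using hlb)⟩
    have hinj := fun c c' => absProb_const_injective (h := h) g.dual (c := c) (c' := c')
    have hxb := hx.sub b
    have hxb' := hx.sub !b
    generalize subProb b x = y at *
    generalize subProb (!b) x = z at *
    rw [he, hu] at hle hle'
    rw [hu] at h0 h1
    -- Otherwise the root would take its absorbing value with probability 1.
    have hp0 : 0 < absProb g.dual y := by
      refine hp.1.lt_of_ne fun e => ?_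
      rw [← e] at h1
      simp at h1
    have hpB := mul_le_mul_of_nonneg_left hB hp.1
    have heq : absProb g.dual y = absProb g.dual z := by
      by_contra hne
      have := iidCost_unbalanced_lt h hp0 (hb.lt_of_ne hne) hq.2
      linarith
    rw [← heq] at hle hle' hB hpB ihB h0
    rw [iidCost_balanced h hp.1] at hle hle'
    have hp1 : absProb g.dual y < 1 := by nlinarith
    have hpA := mul_le_mul_of_nonneg_left hA hp.1
    obtain ⟨c, hc⟩ := ihA hp0 hp1 (le_antisymm hA (by linarith))
    obtain ⟨c', hc'⟩ := ihB hp0 hp1 (le_antisymm hB (by linarith))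
    obtain rfl : y = fun _ => c := funext hc
    obtain rfl : z = fun _ => c' := funext hc'
    obtain rfl : c = c' := hinj c c' (hxb fun _ => false) (hxb' fun _ => false) heq
    refine ⟨c, fun l => ?_⟩
    rcases hbx l with ⟨_, e⟩ | ⟨_, e⟩ <;> exact e

/-! ### Independent distributions -/

theorem isProb_leafProb {h : ℕ} (d : ProbabilityMeasure (Assignment h)) : IsProb (leafProb d) :=
  fun _ => ⟨measureReal_nonneg, measureReal_le_one⟩

theorem real_singleton_of_isID {h : ℕ} {d : ProbabilityMeasure (Assignment h)} (hd : IsID d)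
    (f : Assignment h) : (d : Measure (Assignment h)).real {f} = weight (leafProb d) f := by
  have e : ({f} : Set (Assignment h)) =
      ⋂ l ∈ (Finset.univ : Finset (Leaf h)), (fun f' : Assignment h => f' l) ⁻¹' {f l} := by
    ext f'
    simp [funext_iff]
  have hm := iIndepFun.measure_inter_preimage_eq_mul hd Finset.univ
    (sets := fun l => {f l}) fun _ _ => measurableSet_singleton _
  rw [measureReal_def, e, hm, ENNReal.toReal_prod, weight]
  refine Finset.prod_congr rfl fun l _ => ?_
  rw [← measureReal_def]
  cases f l
  · simp [bitWeight, leafProb, Set.preimage]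
  · have hc : (fun f' : Assignment h => f' l) ⁻¹' {true} = {f' : Assignment h | f' l = false}ᶜ := by
      ext f'; simp
    have hms : MeasurableSet {f' : Assignment h | f' l = false} :=
      (Set.toFinite _).measurableSet
    rw [hc, probReal_compl_eq_one_sub hms]
    simp [bitWeight, leafProb]

theorem integral_of_isID {h : ℕ} {d : ProbabilityMeasure (Assignment h)} (hd : IsID d)
    (φ : Assignment h → ℝ) :
    ∫ f, φ f ∂(d : Measure (Assignment h)) = expect (leafProb d) φ := by
  rw [integral_fintype (Integrable.of_finite)]
  simp only [real_singleton_of_isID hd, smul_eq_mul, expect]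

theorem minCost_of_isID {h : ℕ} (g : Gate) {d : ProbabilityMeasure (Assignment h)}
    (hd : IsID d) : minCost g d = optCost g (leafProb d) := by
  have hm := minCost_isLeast g d
  refine le_antisymm ?_ ?_
  · obtain ⟨A, hA⟩ := exists_expect_eq_optCost g (leafProb d)
    rw [← hA, ← integral_of_isID hd]
    exact hm.2 ⟨A, rfl⟩
  · obtain ⟨A, hA⟩ := hm.1
    rw [← hA]
    exact (optCost_le_expect g A (isProb_leafProb d)).trans_eq (integral_of_isID hd _).symm

/-- Specific to an AND root, whose absorbing value is 0. -/
theorem rootProb_of_isID {h : ℕ} {d : ProbabilityMeasure (Assignment h)}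
    (hd : IsID d) : rootProb .and d = absProb .and (leafProb d) := by
  rw [← expect_absInd, ← integral_of_isID hd, rootProb,
    ← integral_indicator_one (Set.toFinite _).measurableSet]
  refine integral_congr_ae (.of_forall fun f => ?_)
  by_cases hf : rootValue .and f = false <;> simp [absInd, Gate.absorbing, Set.indicator, hf]

/-- Every value in the unit interval is the leaf probability of an IID. -/
theorem exists_isID_leafProb_eq (h : ℕ) {c : ℝ} (hc : c ∈ Set.Icc (0 : ℝ) 1) :
    ∃ d : ProbabilityMeasure (Assignment h), IsID d ∧ leafProb d = fun _ => c := by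
  let ν : Measure Bool :=
    ENNReal.ofReal c • Measure.dirac false + ENNReal.ofReal (1 - c) • Measure.dirac true
  have hν : IsProbabilityMeasure ν := ⟨by
    simp only [ν, Measure.add_apply, Measure.smul_apply, measure_univ, smul_eq_mul, mul_one]
    rw [← ENNReal.ofReal_add hc.1 (sub_nonneg.2 hc.2)]
    simp⟩
  refine ⟨⟨Measure.pi fun _ : Leaf h => ν, inferInstance⟩, ?_, ?_⟩
  · exact iIndepFun_pi (X := fun (_ : Leaf h) (b : Bool) => b) fun _ => aemeasurable_id
  · funext l
    have e := (measurePreserving_eval (fun _ : Leaf h => ν) l).measureReal_preimage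
      (measurableSet_singleton false).nullMeasurableSet
    refine Eq.trans e ?_
    simp [measureReal_def, ν, hc.1]

end AndOr

theorem theorem3 (h : ℕ) (hh : 1 ≤ h) (r : ℝ) (hr0 : 0 < r) (hr1 : r < 1)
    (d : ProbabilityMeasure (AndOr.Assignment h))
    (hd : AndOr.IsEigenDistribution AndOr.Gate.and
      {δ : ProbabilityMeasure (AndOr.Assignment h) |
        AndOr.IsID δ ∧ AndOr.rootProb AndOr.Gate.and δ = r} d) :
    AndOr.IsIID d := by
  obtain ⟨⟨hID, hr⟩, -, hmax⟩ := hd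
  obtain ⟨c, hc, hcr⟩ := AndOr.exists_absProb_const h .and (r := r) ⟨hr0.le, hr1.le⟩
  obtain ⟨δ, hδ, hδc⟩ := AndOr.exists_isID_leafProb_eq h hc
  -- The IID competitor costs `iidCost h r`, so maximality bounds the cost of `d` from below by the
  -- general upper bound.
  have hle := hmax ⟨δ, ⟨hδ, by rw [AndOr.rootProb_of_isID hδ, hδc, hcr]⟩, rfl⟩
  rw [AndOr.minCost_of_isID _ hδ, AndOr.minCost_of_isID _ hID, hδc, AndOr.optCost_const _ hc,
    hcr] at hle
  rw [AndOr.rootProb_of_isID hID] at hr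
  have hx := AndOr.isProb_leafProb d
  have hub := AndOr.optCost_le_iidCost .and hx
  obtain ⟨c', hc'⟩ := AndOr.exists_const_of_optCost_eq .and hx (by rwa [hr]) (by rwa [hr])
    (le_antisymm hub (by rwa [hr]))
  exact ⟨hID, fun l l' => by rw [hc', hc']⟩
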